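/- All graphs are finite and simple. A graph $G$ \emph{contains} a graph $H$, written $H\le G$, if $H$ is isomorphic to an induced subgraph of $G$; otherwise $G$ is \emph{$H$-free}. Let $P_2\cup P_4$ be the disjoint union of a path on $2$ vertices and a path on $4$ vertices, let $C_k$ be the cycle on $k$ vertices, and call an induced $C_k$ with $k\ge 4$ a \emph{$k$-hole}. Let $F_1$ be the (Mycielski--)Grötzsch graph, i.e. the Mycielskian of $C_5$ ($11$ vertices), and let $F_2$ be the $5$-regular Clebsch graph, i.e. the folded $5$-cube ($16$ vertices). A graph $G$ is obtained from a graph $H$ by a \emph{replication-vertex-addition} if $G$ arises from $H$ by adding one new vertex $u$ such that, for some $v\in V(H)$, the vertices $u$ and $v$ are nonadjacent in $G$ and $N_G(u)\subseteq N_G(v)$. Let $G$ be a connected graph that is $(P_2\cup P_4)$-free and $C_3$-free. Then the following hold. (i) $\chi(G)=4$ if and only if $G$ is obtained, by a finite (possibly empty) sequence of replication-vertex-additions, from a graph $H$ with $F_1\le H\le F_2$. Consequently, if $\chi(G)=4$, then $G$ contains $F_1$. (ii) $\chi(G)=3$ if and only if $G$ contains a $5$-hole or a $7$-hole, and $G$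 is $F_1$-free. -/

import Mathlib

universe u

open scoped SimpleGraph

/-- `G` is `H`-free: it has no induced subgraph isomorphic to `H`. -/
def InducedFree {W V : Type*} (H : SimpleGraph W) (G : SimpleGraph V) : Prop :=
  ¬ H.IsIndContained G

/-- The disjoint union of a path on two vertices and a path on four vertices. -/
def P2UnionP4 : SimpleGraph (Fin 2 ⊕ Fin 4) :=
  SimpleGraph.pathGraph 2 ⊕g SimpleGraph.pathGraph 4

/-- `G` contains a hole of length `k`: `k ≥ 4` and `G` has an induced cycle on `k` vertices. -/
def HasHole {V : Type*} (G : SimpleGraph V) (k : ℕ) : Prop :=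
  4 ≤ k ∧ (SimpleGraph.cycleGraph k).IsIndContained G

/-- The vertices of the Mycielskian of a graph on `V`: the original vertices, one shadow vertex for
each of them, and an apex. -/
inductive MycielskiVertex (V : Type u) : Type u
  | base (v : V)
  | shadow (v : V)
  | apex

/-- Adjacency in the Mycielskian of `G`: the original edges remain, the shadow of `v` is joined to
the neighbours of `v` among the original vertices, and the apex is joined to every shadow. -/
def mycielskiAdj {V : Type u} (G : SimpleGraph V) :
    MycielskiVertex V → MycielskiVertex V → Prop
  | .base v, .base w => G.Adj v w
  | .base v, .shadow w => G.Adj v w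
  | .shadow v, .base w => G.Adj v w
  | .shadow _, .apex => True
  | .apex, .shadow _ => True
  | _, _ => False

/-- The Mycielskian of a graph. -/
def mycielskian {V : Type u} (G : SimpleGraph V) : SimpleGraph (MycielskiVertex V) where
  Adj := mycielskiAdj G
  symm := ⟨by
    intro a b h
    cases a <;> cases b <;> simp_all [mycielskiAdj, G.adj_comm]⟩
  loopless := ⟨by
    intro a h
    cases a <;> simp_all [mycielskiAdj]⟩

/-- The Grötzsch graph (the fourth Mycielski graph): the Mycielskian of the 5-cycle, on 11
vertices. -/
def grotzschGraph : SimpleGraph (MycielskiVertex (Fin 5)) :=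
  mycielskian (SimpleGraph.cycleGraph 5)

/-- The (5-regular, triangle-free) Clebsch graph on 16 vertices, as the folded 5-cube: the
4-dimensional cube together with the edges that join antipodal vertices. -/
def clebschGraph : SimpleGraph (Fin 4 → Bool) where
  Adj x y := hammingDist x y = 1 ∨ hammingDist x y = 4
  symm := ⟨fun x y h => by simpa only [hammingDist_comm y x] using h⟩
  loopless := ⟨fun x h => by simp [hammingDist_self] at h⟩

/-- `(u, v)` is a comparable pair of `G`: `u` and `v` are two nonadjacent vertices with
`N(u) ⊆ N(v)`. -/
def IsComparablePair {V : Type u} (G : SimpleGraph V) (u v : V) : Prop :=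
  u ≠ v ∧ ¬ G.Adj u v ∧ G.neighborSet u ⊆ G.neighborSet v

/-- `G` is obtained from `H` by a replication-vertex-addition: `G` is (up to isomorphism) `H` with
one new vertex `u`, and `(u, v)` is a comparable pair of `G` for some old vertex `v`. -/
def IsReplicationVertexAddition {W V : Type u} (H : SimpleGraph W) (G : SimpleGraph V) : Prop :=
  ∃ u v : V, IsComparablePair G u v ∧ Nonempty (H ≃g G.induce ({u}ᶜ : Set V))

/-- `ObtainedByReplications H G`: `G` is obtained from `H` by a finite (possibly empty) sequence of
replication-vertex-additions; graphs are regarded up to isomorphism. -/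
inductive ObtainedByReplications {W : Type u} (H : SimpleGraph W) :
    {V : Type u} → SimpleGraph V → Prop
  | start {V : Type u} {G : SimpleGraph V} (e : H ≃g G) : ObtainedByReplications H G
  | step {V V' : Type u} {G : SimpleGraph V} {G' : SimpleGraph V'}
      (h : ObtainedByReplications H G) (h' : IsReplicationVertexAddition G G') :
      ObtainedByReplications H G'

/-! Everything rests on one fact: a finite graph G without triangles and induced P₂ ∪ P₄ that is not
3-colorable contains the Grötzsch graph (`PatternFree.containsPattern_grotzschPattern`). Deleting u
from a comparable pair (u, v) keeps G non-3-colorable, since u can copy the color of v; so assume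
there are no such pairs. The non-neighbours of any vertex z are not bipartite, hence contain a
5-hole or a 7-hole, and 7 is impossible. Each neighbour of z sees exactly the two cycle-neighbours
of some vertex i of the 5-hole; call it uᵢ. Incomparability of z with the hole vertices yields two
consecutive types, say u₀ and u₁. All five types together form a Grötzsch graph with apex z; the
intermediate configurations are shown to force 3-colorability, largest first.

Conversely, once G contains a Grötzsch graph and is connected, the attachment of a vertex to that
subgraph determines a Clebsch vertex, and adjacency in G is adjacency of these
(`PatternFree.exists_clebsch_map`). So G is a blow-up, that is, it arises by adding twins.

The case analyses are finite computations on attachments to a fixed small graph. -/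

/-! ### Computable graph codes and attachment checks. -/

/-- Adjacency in the graph on `0, …, n - 1` in which the neighbours `j < i` of `i` are the bits
of the `i`-th entry of `H`. -/
def patternAdj (H : List ℕ) (i j : ℕ) : Bool :=
  if j < i then (H.getD i 0).testBit j else if i < j then (H.getD j 0).testBit i else false

/-- `F` is an induced subgraph of `H`, through the map given by the list `ps`. -/
def embedsAt (F H ps : List ℕ) : Bool :=
  (List.range F.length).all fun i => decide (ps.getD i 0 < H.length) &&
    (List.range i).all fun j => patternAdj F i j == patternAdj H (ps.getD i 0) (ps.getD j 0)

def trianglePattern : List ℕ := [0, 1, 3]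

def p2p4Pattern : List ℕ := [0, 1, 2, 4, 0, 16]

/-- The vertices of the graph coded by `H`, each with its neighbourhood as a bit mask. -/
def vertexMasks (H : List ℕ) : List (ℕ × ℕ) :=
  (List.range H.length).map fun i => (2 ^ i,
    ((List.range H.length).filter (patternAdj H i)).foldl (fun m j => m + 2 ^ j) 0)

def disjointMasks (m n : ℕ) : Bool := Nat.beq (Nat.land m n) 0

def findTriangle (L : List (ℕ × ℕ)) (S n : ℕ) : Option (List ℕ) :=
  L.findSome? fun a => bif disjointMasks a.1 S || disjointMasks a.2 S then none else
    some [n, a.1.log2, (Nat.land a.2 S).log2]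

def findP2 (L : List (ℕ × ℕ)) (m : ℕ) (path : List ℕ) : Option (List ℕ) :=
  L.findSome? fun e => bif disjointMasks e.1 m then
    bif Nat.beq (Nat.lor e.2 m) m then none
    else some (path ++ [e.1.log2, (Nat.xor (Nat.lor e.2 m) m).log2]) else none

/-- The three alternatives take the new vertex `n` as an end of the P₄, an inner vertex of the P₄,
or a vertex of the P₂. The search need not be correct or complete: `isBad` rechecks its output with
`embedsAt`. -/
def findP2P4 (L : List (ℕ × ℕ)) (S n : ℕ) : Option (List ℕ) :=
  (L.findSome? fun b => bif disjointMasks b.1 S then none else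
    (L.findSome? fun c => bif disjointMasks b.2 c.1 then none else
      L.findSome? fun d =>
        bif disjointMasks c.2 d.1 || Nat.beq d.1 b.1 || !disjointMasks d.1 S then none else
          findP2 L (Nat.lor (Nat.lor S b.2) (Nat.lor c.2 d.2))
            [n, b.1.log2, c.1.log2, d.1.log2]) <|>
    (L.findSome? fun a => bif disjointMasks a.1 S || Nat.beq a.1 b.1 then none else
      L.findSome? fun d =>
        bif disjointMasks b.2 d.1 || !disjointMasks a.2 d.1 then none else
          findP2 L (Nat.lor (Nat.lor S b.2) (Nat.lor a.2 d.2))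
            [a.1.log2, n, b.1.log2, d.1.log2]) <|>
    (L.findSome? fun c => bif !disjointMasks c.1 (Nat.lor S b.2) then none else
      L.findSome? fun d =>
        bif disjointMasks c.2 d.1 || !disjointMasks d.1 (Nat.lor S b.2) then none else
          L.findSome? fun a => bif disjointMasks c.2 a.1 || Nat.beq d.1 a.1 ||
              !disjointMasks a.1 (Nat.lor S b.2) then none else
            L.findSome? fun e => bif disjointMasks d.2 e.1 || Nat.beq e.1 c.1 ||
                !disjointMasks e.1 (Nat.lor S b.2) || !disjointMasks a.2 e.1 then none else
              some [a.1.log2, c.1.log2, d.1.log2, e.1.log2, b.1.log2, n]))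

/-- A search for a triangle or an induced `P₂ ∪ P₄` containing the last vertex of the graph
coded by `H ++ [S]`. -/
def isBad (H : List ℕ) (L : List (ℕ × ℕ)) (S : ℕ) : Bool :=
  (match findTriangle L S H.length with
    | some ps => embedsAt trianglePattern (H ++ [S]) ps
    | none => false) ||
  (match findP2P4 L S H.length with
    | some ps => embedsAt p2p4Pattern (H ++ [S]) ps
    | none => false)

def extendAttachments (H : List ℕ) (L : List (ℕ × ℕ)) (b : ℕ) : List ℕ → List ℕ
  | [] => []
  | S :: T => (bif isBad H L S then [] else [S]) ++
      (bif isBad H L (S + b) then [] else [S + b]) ++ extendAttachments H L b T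

/-- The possible neighbourhoods of a vertex in the first `k` vertices of the graph `H`. -/
def attachments (H : List ℕ) : ℕ → List ℕ
  | 0 => [0]
  | k + 1 => extendAttachments (H.take (k + 1)) (vertexMasks (H.take (k + 1))) (2 ^ k)
      (attachments H k)

/-- A certificate is a graph with a list of vertices; `H` is excluded by it if these vertices
induce this graph in `H`. -/
def isExcluded (certs : List (List ℕ × List ℕ)) (H : List ℕ) : Bool :=
  certs.any fun p => embedsAt p.1 H p.2

def admissible (certs : List (List ℕ × List ℕ)) (H : List ℕ) : List ℕ :=
  (attachments H H.length).filter fun S => !isExcluded certs (H ++ [S])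

/-- Two vertices attached to `H` along `S` and `T` must be nonadjacent (if `b` is `0`) or adjacent
(if `b` is `2 ^ H.length`). -/
def pairExcluded (certs : List (List ℕ × List ℕ)) (H : List ℕ) (b S T : ℕ) : Bool :=
  isExcluded certs (H ++ [S] ++ [T + b]) || isExcluded certs (H ++ [T] ++ [S + b]) ||
    isBad (H ++ [S]) (vertexMasks (H ++ [S])) (T + b)

def independentClass (certs : List (List ℕ × List ℕ)) (H c : List ℕ) : Bool :=
  c.all fun S => c.all fun T => pairExcluded certs H (2 ^ H.length) S T

/-- The attachment of a vertex to a copy of `H` is to determine its color. -/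
def coloringCheck (certs : List (List ℕ × List ℕ)) (H c₀ c₁ c₂ : List ℕ) : Bool :=
  ((admissible certs H).all fun S => c₀.elem S || c₁.elem S || c₂.elem S) &&
    independentClass certs H c₀ && independentClass certs H c₁ && independentClass certs H c₂

def grotzschPattern : List ℕ := [0, 1, 2, 4, 9, 18, 5, 10, 20, 9, 992]

/-! ### Soundness of the checks. -/

section Patterns

variable {V : Type*} {G : SimpleGraph V}

/-- The vertices `f 0, f 1, …` induce in `G` the graph coded by `H`. -/
def Realizes (G : SimpleGraph V) (H : List ℕ) (f : ℕ → V) : Prop :=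
  ∀ i < H.length, ∀ j < H.length, patternAdj H i j = true ↔ G.Adj (f i) (f j)

/-- Injectivity of `f` is not required; for twin-free patterns it is automatic. -/
def ContainsPattern (G : SimpleGraph V) (H : List ℕ) : Prop := ∃ f, Realizes G H f

/-- `x` is adjacent to exactly those of the vertices `f 0, …, f (n - 1)` whose index is in `S`. -/
def Attached (G : SimpleGraph V) (f : ℕ → V) (n S : ℕ) (x : V) : Prop :=
  ∀ i < n, S.testBit i = true ↔ G.Adj x (f i)

theorem patternAdj_comm (H : List ℕ) (i j : ℕ) : patternAdj H i j = patternAdj H j i := by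
  unfold patternAdj
  split_ifs <;> first | rfl | omega

theorem patternAdj_self (H : List ℕ) (i : ℕ) : patternAdj H i i = false := by
  simp [patternAdj]

theorem realizes_iff {H : List ℕ} {f : ℕ → V} :
    Realizes G H f ↔
      ∀ i < H.length, ∀ j < i, (H.getD i 0).testBit j = true ↔ G.Adj (f i) (f j) := by
  constructor
  · intro h i hi j hj
    rw [← h i hi j (hj.trans hi), patternAdj, if_pos hj]
  · intro h i hi j hj
    rcases lt_trichotomy j i with hij | rfl | hij
    · rw [← h i hi j hij, patternAdj, if_pos hij]
    · simp [patternAdj_self]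
    · rw [G.adj_comm, ← h j hj i hij, patternAdj_comm, patternAdj, if_pos hij]

theorem Realizes.take {H : List ℕ} {f : ℕ → V} (h : Realizes G H f) (k : ℕ) :
    Realizes G (H.take k) f := by
  rw [realizes_iff] at h ⊢
  intro i hi j hj
  rw [List.length_take, lt_min_iff] at hi
  rw [← h i hi.2 j hj]
  simp [List.getD_eq_getElem?_getD, hi.1]

theorem Realizes.concat {H : List ℕ} {f : ℕ → V} (h : Realizes G H f) {S : ℕ} {x : V}
    (hx : Attached G f H.length S x) :
    Realizes G (H ++ [S]) (Function.update f H.length x) := by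
  rw [realizes_iff] at h ⊢
  intro i hi j hj
  rw [List.length_append, List.length_singleton] at hi
  rcases Nat.lt_succ_iff_lt_or_eq.mp hi with hi | rfl
  · rw [Function.update_of_ne hi.ne, Function.update_of_ne (hj.trans hi).ne, ← h i hi j hj,
      List.getD_append _ _ _ _ hi]
  · rw [Function.update_self, Function.update_of_ne hj.ne, ← hx j hj]
    simp

theorem Realizes.contains_of_embedsAt {F H ps : List ℕ} {f : ℕ → V} (h : Realizes G H f)
    (hp : embedsAt F H ps = true) : ContainsPattern G F := by
  refine ⟨fun i => f (ps.getD i 0), realizes_iff.mpr fun i hi j hj => ?_⟩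
  simp only [embedsAt, List.all_eq_true, List.mem_range, Bool.and_eq_true, decide_eq_true_eq,
    beq_iff_eq] at hp
  have h1 := hp i hi
  rw [← h _ h1.1 _ (hp j (hj.trans hi)).1, ← h1.2 j hj, patternAdj, if_pos hj]

theorem ContainsPattern.of_embedsAt {F H : List ℕ} (h : ContainsPattern G H) (ps : List ℕ)
    (hp : embedsAt F H ps = true) : ContainsPattern G F :=
  h.choose_spec.contains_of_embedsAt hp

/-- `G` has no triangle and no induced `P₂ ∪ P₄`. -/
structure PatternFree (G : SimpleGraph V) : Prop where
  triangle : ¬ ContainsPattern G trianglePattern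
  p2p4 : ¬ ContainsPattern G p2p4Pattern

theorem PatternFree.isBad_eq_false (hG : PatternFree G) {H : List ℕ} {S : ℕ}
    (h : ContainsPattern G (H ++ [S])) (L : List (ℕ × ℕ)) : isBad H L S = false := by
  by_contra hb
  simp only [isBad, Bool.not_eq_false, Bool.or_eq_true] at hb
  rcases hb with hb | hb
  · split at hb
    · exact hG.triangle (h.of_embedsAt _ hb)
    · simp at hb
  · split at hb
    · exact hG.p2p4 (h.of_embedsAt _ hb)
    · simp at hb

theorem isExcluded_eq_false {certs : List (List ℕ × List ℕ)}
    (hc : ∀ p ∈ certs, ¬ ContainsPattern G p.1) {H : List ℕ} (h : ContainsPattern G H) :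
    isExcluded certs H = false := by
  by_contra hb
  simp only [isExcluded, Bool.not_eq_false, List.any_eq_true] at hb
  obtain ⟨p, hp, hb⟩ := hb
  exact hc p hp (h.of_embedsAt _ hb)

theorem mem_extendAttachments {H : List ℕ} {L : List (ℕ × ℕ)} {b S T : ℕ} {l : List ℕ}
    (hS : S ∈ l) (hT : T = S ∨ T = S + b) (hb : isBad H L T = false) :
    T ∈ extendAttachments H L b l := by
  induction l with
  | nil => simp at hS
  | cons A l ih =>
    simp only [extendAttachments, List.mem_append]
    rcases List.mem_cons.mp hS with rfl | hS
    · rcases hT with rfl | rfl <;> simp [hb]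
    · exact Or.inr (ih hS)

theorem testBit_add_two_pow_of_lt {S k : ℕ} (hS : S < 2 ^ k) (i : ℕ) :
    (S + 2 ^ k).testBit i = (S.testBit i || decide (i = k)) := by
  rw [Nat.add_comm]
  rcases lt_trichotomy i k with h | rfl | h
  · rw [Nat.testBit_two_pow_add_gt h]; simp [h.ne]
  · rw [Nat.testBit_two_pow_add_eq, Nat.testBit_lt_two_pow hS]; simp
  · have h1 : 2 ^ k + S < 2 ^ i := by
      have : 2 ^ (k + 1) ≤ 2 ^ i := Nat.pow_le_pow_right (by norm_num) h
      rw [pow_succ] at this; omega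
    rw [Nat.testBit_lt_two_pow h1, Nat.testBit_lt_two_pow (by omega)]
    simp [h.ne']

theorem Attached.zero {f : ℕ → V} {n S : ℕ} {x y : V} (h : Attached G f n S x) (hS : S < 2 ^ n)
    (hy : ¬ G.Adj x y) : Attached G (Function.update f n y) (n + 1) S x := by
  intro i hi
  rcases Nat.lt_succ_iff_lt_or_eq.mp hi with hi | rfl
  · rw [Function.update_of_ne hi.ne, h i hi]
  · simp [Nat.testBit_lt_two_pow hS, hy]

theorem Attached.add {f : ℕ → V} {n S : ℕ} {x y : V} (h : Attached G f n S x) (hS : S < 2 ^ n)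
    (hy : G.Adj x y) : Attached G (Function.update f n y) (n + 1) (S + 2 ^ n) x := by
  intro i hi
  rw [testBit_add_two_pow_of_lt hS]
  rcases Nat.lt_succ_iff_lt_or_eq.mp hi with hi | rfl
  · rw [Function.update_of_ne hi.ne, ← h i hi]; simp [hi.ne]
  · simp [hy]

/-- Restricting an attachment to fewer vertices of `H` never creates a forbidden pattern, so the
true attachment survives the filter at every stage. -/
theorem PatternFree.exists_attachment (hG : PatternFree G) {H : List ℕ} {f : ℕ → V}
    (h : Realizes G H f) (x : V) {k : ℕ} (hk : k ≤ H.length) :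
    ∃ S ∈ attachments H k, S < 2 ^ k ∧ Attached G f k S x := by
  induction k with
  | zero => exact ⟨0, by simp [attachments], by simp, fun i hi => by omega⟩
  | succ k ih =>
    obtain ⟨S, hS, hlt, hx⟩ := ih (by omega)
    have key : ∀ T, (T = S ∨ T = S + 2 ^ k) → Attached G f (k + 1) T x →
        T ∈ attachments H (k + 1) := by
      intro T hT hxT
      refine mem_extendAttachments hS hT (hG.isBad_eq_false ⟨_, (h.take (k + 1)).concat (x := x) ?_⟩ _)
      rwa [List.length_take, min_eq_left hk]
    -- Lets the one-vertex extension lemmas be applied with the new vertex `f k` already in place.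
    have hup : Function.update f k (f k) = f := Function.update_eq_self k f
    by_cases hadj : G.Adj x (f k)
    · have := hx.add hlt hadj
      rw [hup] at this
      exact ⟨_, key _ (Or.inr rfl) this, by rw [pow_succ]; omega, this⟩
    · have := hx.zero hlt hadj
      rw [hup] at this
      exact ⟨_, key _ (Or.inl rfl) this, by rw [pow_succ]; omega, this⟩

theorem PatternFree.exists_admissible (hG : PatternFree G) {certs : List (List ℕ × List ℕ)}
    (hc : ∀ p ∈ certs, ¬ ContainsPattern G p.1) {H : List ℕ} {f : ℕ → V}
    (h : Realizes G H f) (x : V) :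
    ∃ S ∈ admissible certs H, S < 2 ^ H.length ∧ Attached G f H.length S x := by
  obtain ⟨S, hS, hlt, hx⟩ := hG.exists_attachment h x le_rfl
  refine ⟨S, List.mem_filter.mpr ⟨hS, ?_⟩, hlt, hx⟩
  simp [isExcluded_eq_false hc ⟨_, h.concat hx⟩]

theorem PatternFree.pairExcluded_adj (hG : PatternFree G) {certs : List (List ℕ × List ℕ)}
    (hc : ∀ p ∈ certs, ¬ ContainsPattern G p.1) {H : List ℕ} {f : ℕ → V}
    (h : Realizes G H f) {S T : ℕ} {x y : V} (hS : S < 2 ^ H.length) (hT : T < 2 ^ H.length)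
    (hx : Attached G f H.length S x) (hy : Attached G f H.length T y) (hxy : G.Adj x y) :
    pairExcluded certs H (2 ^ H.length) S T = false := by
  have key : ∀ {S T : ℕ} {x y : V}, S < 2 ^ H.length → T < 2 ^ H.length →
      Attached G f H.length S x → Attached G f H.length T y → G.Adj x y →
      ContainsPattern G (H ++ [S] ++ [T + 2 ^ H.length]) := fun hS hT hx hy hxy =>
    ⟨_, (h.concat hx).concat (by simpa using hy.add hT hxy.symm)⟩
  have h1 := key hS hT hx hy hxy
  simp only [pairExcluded, isExcluded_eq_false hc h1, hG.isBad_eq_false h1,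
    isExcluded_eq_false hc (key hT hS hy hx hxy.symm), Bool.or_self]

theorem PatternFree.pairExcluded_not_adj (hG : PatternFree G) {certs : List (List ℕ × List ℕ)}
    (hc : ∀ p ∈ certs, ¬ ContainsPattern G p.1) {H : List ℕ} {f : ℕ → V}
    (h : Realizes G H f) {S T : ℕ} {x y : V} (hS : S < 2 ^ H.length) (hT : T < 2 ^ H.length)
    (hx : Attached G f H.length S x) (hy : Attached G f H.length T y) (hxy : ¬ G.Adj x y) :
    pairExcluded certs H 0 S T = false := by
  have key : ∀ {S T : ℕ} {x y : V}, S < 2 ^ H.length → T < 2 ^ H.length →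
      Attached G f H.length S x → Attached G f H.length T y → ¬ G.Adj x y →
      ContainsPattern G (H ++ [S] ++ [T + 0]) := fun hS hT hx hy hxy =>
    ⟨_, (h.concat hx).concat (by simpa using hy.zero hT fun h => hxy h.symm)⟩
  have h1 := key hS hT hx hy hxy
  simp only [pairExcluded, isExcluded_eq_false hc h1, hG.isBad_eq_false h1,
    isExcluded_eq_false hc (key hT hS hy hx fun h => hxy h.symm), Bool.or_self]

/-- Every vertex of `G`, including those of the copy of `H`, has an admissible attachment; adjacent
vertices cannot have attachments in the same class. -/
theorem PatternFree.colorable_three (hG : PatternFree G) {certs : List (List ℕ × List ℕ)}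
    {H c₀ c₁ c₂ : List ℕ} (hcheck : coloringCheck certs H c₀ c₁ c₂ = true)
    (hc : ∀ p ∈ certs, ¬ ContainsPattern G p.1) (h : ContainsPattern G H) :
    G.Colorable 3 := by
  obtain ⟨f, hf⟩ := h
  choose S hS hlt hatt using hG.exists_admissible hc hf
  simp only [coloringCheck, Bool.and_eq_true, List.all_eq_true, Bool.or_eq_true,
    List.elem_eq_mem, decide_eq_true_eq] at hcheck
  obtain ⟨⟨⟨hcov, h0⟩, h1⟩, h2⟩ := hcheck
  have hcol : ∀ x, ∃ i : Fin 3, S x ∈ (![c₀, c₁, c₂] : Fin 3 → List ℕ) i := by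
    intro x
    rcases hcov _ (hS x) with (hx | hx) | hx
    exacts [⟨0, hx⟩, ⟨1, hx⟩, ⟨2, hx⟩]
  choose col hcol using hcol
  have hind : ∀ i, independentClass certs H ((![c₀, c₁, c₂] : Fin 3 → List ℕ) i) = true := by
    intro i; fin_cases i <;> assumption
  refine ⟨SimpleGraph.Coloring.mk col fun {x y} hxy heq => ?_⟩
  have h3 := hind (col x)
  simp only [independentClass, List.all_eq_true] at h3
  have h4 := h3 (S x) (hcol x) (S y) (heq ▸ hcol y)
  rw [hG.pairExcluded_adj hc hf (hlt x) (hlt y) (hatt x) (hatt y) hxy] at h4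
  exact Bool.noConfusion h4

end Patterns

/-! ### 3-colorability around a 5-hole with an isolated vertex. -/

/-- The disjoint union of a 5-cycle and a vertex `z`. -/
def cycleIsolatedPattern : List ℕ := [0, 1, 2, 4, 9, 0]

/-! Below, `uᵢ` is a neighbour of `z` attached to the two neighbours of the `i`-th vertex of the
5-cycle. -/

/-- The 5-cycle with `z`, `u₀` and `u₁`. -/
def corePattern01 : List ℕ := [0, 1, 2, 4, 9, 0, 50, 37]

def corePattern012 : List ℕ := [0, 1, 2, 4, 9, 0, 50, 37, 42]

def corePattern013 : List ℕ := [0, 1, 2, 4, 9, 0, 50, 37, 52]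

def corePattern0123 : List ℕ := [0, 1, 2, 4, 9, 0, 50, 37, 42, 52]

/-- `corePattern0123` with a further vertex adjacent to `u₀` and to the third vertex of the
cycle. -/
def corePatternExtended : List ℕ := [0, 1, 2, 4, 9, 0, 50, 37, 42, 52, 68]

def certsExtended : List (List ℕ × List ℕ) :=
  [(grotzschPattern, [0, 1, 2, 3, 4, 6, 7, 8, 9, 11, 5]),
    (grotzschPattern, [1, 2, 7, 5, 8, 3, 0, 9, 11, 6, 4]),
    (grotzschPattern, [0, 4, 6, 12, 11, 9, 1, 3, 10, 7, 2])]

/-- In the first certificate the new vertex 10 plays u₄ and completes the Grötzsch graph with apex z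
= 5. The last certificate is the mirror image of the third. -/
def certs0123 : List (List ℕ × List ℕ) :=
  [(grotzschPattern, [0, 1, 2, 3, 4, 6, 7, 8, 9, 10, 5]),
    (grotzschPattern, [1, 2, 7, 5, 8, 3, 0, 9, 10, 6, 4]),
    (corePatternExtended, [0, 1, 2, 3, 4, 5, 6, 7, 8, 9, 10]),
    (corePatternExtended, [3, 2, 1, 0, 4, 5, 9, 8, 7, 6, 10])]

def certs013 : List (List ℕ × List ℕ) :=
  [(corePattern0123, [1, 0, 4, 3, 2, 5, 7, 6, 9, 8]),
    (corePattern0123, [0, 1, 2, 3, 4, 5, 6, 7, 9, 8]),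
    (corePattern0123, [1, 0, 4, 8, 2, 10, 7, 6, 9, 3]),
    (corePattern0123, [0, 1, 2, 8, 4, 10, 6, 7, 9, 3])]

def certs012 : List (List ℕ × List ℕ) :=
  [(corePattern0123, [2, 1, 0, 4, 3, 5, 8, 7, 6, 9]),
    (corePattern0123, [0, 1, 2, 3, 4, 5, 6, 7, 8, 9]),
    (corePattern0123, [0, 1, 6, 5, 7, 3, 2, 4, 8, 9]),
    (corePattern0123, [2, 1, 8, 5, 7, 4, 0, 3, 6, 9])]

/-- The last certificate involves two new vertices, 8 in the role of z and 9 in that of u₃, so it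
only acts through `pairExcluded`. -/
def certs01 : List (List ℕ × List ℕ) :=
  [(corePattern012, [1, 0, 4, 3, 2, 5, 7, 6, 8]),
    (corePattern012, [0, 1, 2, 3, 4, 5, 6, 7, 8]),
    (corePattern013, [0, 1, 2, 3, 4, 5, 6, 7, 8]),
    (corePattern013, [0, 1, 6, 5, 7, 3, 2, 4, 8]),
    (corePattern013, [0, 1, 2, 3, 4, 8, 6, 7, 9])]

theorem coloringCheck_extended : coloringCheck certsExtended corePatternExtended
    [0, 37, 52, 68, 276, 325] [42, 146, 514, 1074, 1674] [200, 585, 960, 1793] = true := by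
  decide +kernel

theorem coloringCheck_0123 : coloringCheck certs0123 corePattern0123
    [0, 37, 50, 52, 276] [42, 146, 200, 650] [325, 585, 769, 960] = true := by
  decide +kernel

theorem coloringCheck_013 : coloringCheck certs013 corePattern013
    [0, 20, 37, 52, 68, 69] [192, 200, 257, 258, 329, 394, 448] [50, 144, 146] = true := by
  decide +kernel

theorem coloringCheck_012 : coloringCheck certs012 corePattern012
    [37, 68, 73, 325] [0, 2, 42, 50, 138, 146] [257, 276, 448] = true := by
  decide +kernel

theorem coloringCheck_01 : coloringCheck certs01 corePattern01
    [37, 68, 69, 73] [50, 138, 144, 146] [0, 1, 2, 20, 192] = true := by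
  decide +kernel

/-- A graph without triangles, induced `P₂ ∪ P₄` and induced Grötzsch graphs which contains
`corePattern01` is 3-colorable. -/
theorem PatternFree.colorable_three_of_core {V : Type*} {G : SimpleGraph V} (hG : PatternFree G)
    (hF : ¬ ContainsPattern G grotzschPattern) (h : ContainsPattern G corePattern01) :
    G.Colorable 3 := by
  -- A configuration shown to force 3-colorability becomes a forbidden pattern for the smaller ones.
  by_contra hcol
  have hE : ¬ ContainsPattern G corePatternExtended := fun h =>
    hcol (hG.colorable_three coloringCheck_extended (by simp [certsExtended, hF]) h)
  have h0123 : ¬ ContainsPattern G corePattern0123 := fun h =>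
    hcol (hG.colorable_three coloringCheck_0123 (by simp [certs0123, hF, hE]) h)
  have h013 : ¬ ContainsPattern G corePattern013 := fun h =>
    hcol (hG.colorable_three coloringCheck_013 (by simp [certs013, h0123]) h)
  have h012 : ¬ ContainsPattern G corePattern012 := fun h =>
    hcol (hG.colorable_three coloringCheck_012 (by simp [certs012, h0123]) h)
  exact hcol (hG.colorable_three coloringCheck_01 (by simp [certs01, h012, h013]) h)

/-! ### Graphs containing the Grötzsch graph map to the Clebsch graph. -/

/-- Adjacency in the Clebsch graph, for vertices written as 4-bit numbers. -/
def clebschCodeAdj (a b : ℕ) : Bool :=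
  let d := Nat.xor a b
  Nat.beq d 1 || Nat.beq d 2 || Nat.beq d 4 || Nat.beq d 8 || Nat.beq d 15

/-- The vertices of a Grötzsch graph in the Clebsch graph. -/
def grotzschInClebsch : List ℕ := [13, 5, 10, 11, 9, 1, 2, 4, 8, 15, 0]

/-- The vertex of the Clebsch graph with neighbourhood `S` in its Grötzsch subgraph. -/
def clebschCode (S : ℕ) : ℕ :=
  ((List.range 16).find? fun a => (List.range 11).all fun i =>
    clebschCodeAdj a (grotzschInClebsch.getD i 0) == S.testBit i).getD 0

/-- A vertex with empty attachment has no neighbours at all; between nonempty attachments, the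
Clebsch codes decide adjacency by ruling out the opposite option. -/
def clebschCheck : Bool :=
  (admissible [] grotzschPattern).all fun S => (admissible [] grotzschPattern).all fun T =>
    bif Nat.beq S 0 then pairExcluded [] grotzschPattern (2 ^ 11) S T else
      Nat.beq T 0 || pairExcluded [] grotzschPattern
        (bif clebschCodeAdj (clebschCode S) (clebschCode T) then 0 else 2 ^ 11) S T

def clebschVertex (a : ℕ) : Fin 4 → Bool := fun i => a.testBit i

instance : DecidableRel clebschGraph.Adj := fun x y =>
  inferInstanceAs (Decidable (hammingDist x y = 1 ∨ hammingDist x y = 4))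

theorem clebschGraph_adj_clebschVertex : ∀ a < 16, ∀ b < 16,
    clebschGraph.Adj (clebschVertex a) (clebschVertex b) ↔ clebschCodeAdj a b = true := by
  decide +kernel

theorem clebschCode_lt (S : ℕ) : clebschCode S < 16 := by
  unfold clebschCode
  rcases h : List.find? _ (List.range 16) with _ | a
  · simp
  · simpa using List.mem_range.mp (List.mem_of_find?_eq_some h)

theorem clebschCheck_eq_true : clebschCheck = true := by decide +kernel

/-- A connected graph without triangles and induced `P₂ ∪ P₄` which contains the Grötzsch graph
is a blow-up of an induced subgraph of the Clebsch graph. -/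
theorem PatternFree.exists_clebsch_map {V : Type*} {G : SimpleGraph V} (hG : PatternFree G)
    (hconn : G.Connected) (h : ContainsPattern G grotzschPattern) :
    ∃ t : V → Fin 4 → Bool, ∀ x y, G.Adj x y ↔ clebschGraph.Adj (t x) (t y) := by
  obtain ⟨f, hf⟩ := h
  have hc : ∀ p ∈ ([] : List (List ℕ × List ℕ)), ¬ ContainsPattern G p.1 := by simp
  choose S hS hlt hatt using hG.exists_admissible hc hf
  have hcheck := clebschCheck_eq_true
  simp only [clebschCheck, List.all_eq_true] at hcheck
  have hlen : grotzschPattern.length = 11 := rfl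
  -- Connectedness enters here: an unattached vertex would be isolated.
  have hne : ∀ x, S x ≠ 0 := by
    intro x h0
    have h01 : G.Adj (f 0) (f 1) := by
      rw [← hf 0 (by simp [hlen]) 1 (by simp [hlen])]; rfl
    have : Nontrivial V := ⟨_, _, h01.ne⟩
    obtain ⟨y, hxy⟩ := hconn.preconnected.exists_adj_of_nontrivial x
    have h1 := hcheck (S x) (hS x) (S y) (hS y)
    have hx : Nat.beq (S x) 0 = true := by rw [h0]; rfl
    have h2 := hG.pairExcluded_adj hc hf (hlt x) (hlt y) (hatt x) (hatt y) hxy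
    rw [hlen] at h2
    rw [hx, cond_true, h2] at h1
    exact Bool.noConfusion h1
  refine ⟨fun x => clebschVertex (clebschCode (S x)), fun x y => ?_⟩
  rw [clebschGraph_adj_clebschVertex _ (clebschCode_lt _) _ (clebschCode_lt _)]
  have h1 := hcheck (S x) (hS x) (S y) (hS y)
  have hx : Nat.beq (S x) 0 = false := Bool.eq_false_iff.mpr fun h => hne x (Nat.eq_of_beq_eq_true h)
  have hy : Nat.beq (S y) 0 = false := Bool.eq_false_iff.mpr fun h => hne y (Nat.eq_of_beq_eq_true h)
  rw [hx, hy, cond_false, Bool.false_or] at h1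
  by_cases hadj : G.Adj x y
  · have h2 := hG.pairExcluded_adj hc hf (hlt x) (hlt y) (hatt x) (hatt y) hadj
    rw [hlen] at h2
    cases h3 : clebschCodeAdj (clebschCode (S x)) (clebschCode (S y))
    · rw [h3, cond_false, h2] at h1
      exact Bool.noConfusion h1
    · simp [hadj]
  · have h2 := hG.pairExcluded_not_adj hc hf (hlt x) (hlt y) (hatt x) (hatt y) hadj
    cases h3 : clebschCodeAdj (clebschCode (S x)) (clebschCode (S y))
    · simp [hadj]
    · rw [h3, cond_true, h2] at h1
      exact Bool.noConfusion h1

/-! ### From patterns to induced subgraphs. -/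

section

variable {V W : Type*} {G : SimpleGraph V}

/-- Two vertices with the same image would have the same neighbours in `F`. -/
theorem isIndContained_of_twinFree {F : SimpleGraph W}
    (hF : ∀ a b, (∀ c, F.Adj a c ↔ F.Adj b c) → a = b) (g : W → V)
    (hg : ∀ a b, G.Adj (g a) (g b) ↔ F.Adj a b) : F ⊴ G := by
  refine ⟨⟨⟨g, fun a b hab => hF a b fun c => ?_⟩, hg _ _⟩⟩
  rw [← hg, ← hg, hab]

theorem containsPattern_of_isIndContained {F : SimpleGraph W} {H : List ℕ}
    (hF : ContainsPattern F H) (h : F ⊴ G) : ContainsPattern G H := by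
  obtain ⟨e, he⟩ := hF
  obtain ⟨φ⟩ := h
  exact ⟨φ ∘ e, fun i hi j hj => (he i hi j hj).trans φ.map_adj_iff.symm⟩

theorem isIndContained_of_containsPattern {F : SimpleGraph W} {H : List ℕ} (h : ContainsPattern G H)
    (hF : ∀ a b, (∀ c, F.Adj a c ↔ F.Adj b c) → a = b) (g : W → ℕ) (hlen : ∀ a, g a < H.length)
    (hg : ∀ a b, patternAdj H (g a) (g b) = true ↔ F.Adj a b) : F ⊴ G := by
  obtain ⟨f, hf⟩ := h
  exact isIndContained_of_twinFree hF (f ∘ g) fun a b =>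
    (hf _ (hlen a) _ (hlen b)).symm.trans (hg a b)

def cyclePattern5 : List ℕ := [0, 1, 2, 4, 9]

def cyclePattern7 : List ℕ := [0, 1, 2, 4, 8, 16, 33]

instance (n : ℕ) : DecidableRel (SimpleGraph.pathGraph n).Adj := fun _ _ =>
  decidable_of_iff' _ SimpleGraph.pathGraph_adj

theorem triangle_isIndContained (h : ContainsPattern G trianglePattern) :
    SimpleGraph.cycleGraph 3 ⊴ G :=
  isIndContained_of_containsPattern h (by decide) (fun i => i.val) (by decide) (by decide)

theorem cycleGraph_five_isIndContained (h : ContainsPattern G cyclePattern5) :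
    SimpleGraph.cycleGraph 5 ⊴ G :=
  isIndContained_of_containsPattern h (by decide) (fun i => i.val) (by decide) (by decide)

theorem cycleGraph_seven_isIndContained (h : ContainsPattern G cyclePattern7) :
    SimpleGraph.cycleGraph 7 ⊴ G :=
  isIndContained_of_containsPattern h (by decide) (fun i => i.val) (by decide) (by decide)

instance : DecidableRel P2UnionP4.Adj
  | .inl a, .inl b => inferInstanceAs (Decidable ((SimpleGraph.pathGraph 2).Adj a b))
  | .inr a, .inr b => inferInstanceAs (Decidable ((SimpleGraph.pathGraph 4).Adj a b))
  | .inl _, .inr _ => isFalse (by simp [P2UnionP4])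
  | .inr _, .inl _ => isFalse (by simp [P2UnionP4])

theorem p2UnionP4_isIndContained (h : ContainsPattern G p2p4Pattern) : P2UnionP4 ⊴ G :=
  isIndContained_of_containsPattern h (by decide)
    (Sum.elim (fun i => i.val + 4) (fun i => i.val)) (by decide) (by decide)

def mycielskiIndex : MycielskiVertex (Fin 5) → ℕ
  | .base i => i
  | .shadow i => i + 5
  | .apex => 10

def mycielskiOfIndex (n : ℕ) : MycielskiVertex (Fin 5) :=
  if h : n < 5 then .base ⟨n, h⟩ else if h : n - 5 < 5 then .shadow ⟨n - 5, h⟩ else .apex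

instance : DecidableRel grotzschGraph.Adj
  | .base v, .base w => inferInstanceAs (Decidable ((SimpleGraph.cycleGraph 5).Adj v w))
  | .base v, .shadow w => inferInstanceAs (Decidable ((SimpleGraph.cycleGraph 5).Adj v w))
  | .shadow v, .base w => inferInstanceAs (Decidable ((SimpleGraph.cycleGraph 5).Adj v w))
  | .shadow _, .apex => isTrue trivial
  | .apex, .shadow _ => isTrue trivial
  | .base _, .apex => isFalse id
  | .apex, .base _ => isFalse id
  | .apex, .apex => isFalse id
  | .shadow _, .shadow _ => isFalse id

theorem mycielskiOfIndex_mycielskiIndex (a : MycielskiVertex (Fin 5)) :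
    mycielskiOfIndex (mycielskiIndex a) = a := by
  rcases a with i | i | _ <;> simp [mycielskiIndex, mycielskiOfIndex]

theorem mycielskiIndex_lt (a : MycielskiVertex (Fin 5)) : mycielskiIndex a < 11 := by
  rcases a with i | i | _ <;> simp [mycielskiIndex] <;> omega

theorem realizes_grotzschPattern :
    Realizes grotzschGraph grotzschPattern mycielskiOfIndex := by
  unfold Realizes
  decide +kernel

theorem patternAdj_mycielskiIndex (a b : MycielskiVertex (Fin 5)) :
    patternAdj grotzschPattern (mycielskiIndex a) (mycielskiIndex b) = true ↔
      grotzschGraph.Adj a b := by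
  rw [realizes_grotzschPattern _ (mycielskiIndex_lt a) _ (mycielskiIndex_lt b),
    mycielskiOfIndex_mycielskiIndex, mycielskiOfIndex_mycielskiIndex]

theorem grotzschPattern_twinFree : ∀ i < 11, ∀ j < 11,
    (∀ k < 11, patternAdj grotzschPattern i k = patternAdj grotzschPattern j k) → i = j := by
  decide +kernel

theorem containsPattern_grotzschPattern_iff :
    ContainsPattern G grotzschPattern ↔ grotzschGraph ⊴ G := by
  refine ⟨fun h => isIndContained_of_containsPattern h (fun a b hab => ?_) mycielskiIndex
    mycielskiIndex_lt patternAdj_mycielskiIndex,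
    containsPattern_of_isIndContained ⟨_, realizes_grotzschPattern⟩⟩
  rw [← mycielskiOfIndex_mycielskiIndex a, ← mycielskiOfIndex_mycielskiIndex b]
  congr 1
  refine grotzschPattern_twinFree _ (mycielskiIndex_lt a) _ (mycielskiIndex_lt b) fun k hk => ?_
  have h := hab (mycielskiOfIndex k)
  have key : ∀ c, grotzschGraph.Adj c (mycielskiOfIndex k) ↔
      patternAdj grotzschPattern (mycielskiIndex c) k = true := fun c => by
    rw [realizes_grotzschPattern _ (mycielskiIndex_lt c) _ hk, mycielskiOfIndex_mycielskiIndex]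
  rw [key, key] at h
  exact Bool.eq_iff_iff.mpr h

theorem PatternFree.of_inducedFree (hP : InducedFree P2UnionP4 G)
    (hC : InducedFree (SimpleGraph.cycleGraph 3) G) : PatternFree G :=
  ⟨fun h => hC (triangle_isIndContained h), fun h => hP (p2UnionP4_isIndContained h)⟩

theorem not_exists_two_coloring_five_cycle : ∀ k a₀ a₁ a₂ a₃ a₄ : Fin 3,
    ¬ (a₀ ≠ k ∧ a₁ ≠ k ∧ a₂ ≠ k ∧ a₃ ≠ k ∧ a₄ ≠ k ∧
      a₀ ≠ a₁ ∧ a₁ ≠ a₂ ∧ a₂ ≠ a₃ ∧ a₃ ≠ a₄ ∧ a₄ ≠ a₀) := by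
  decide +kernel

/-- The Grötzsch graph is not 3-colorable. -/
theorem not_colorable_three_of_grotzschPattern (h : ContainsPattern G grotzschPattern) :
    ¬ G.Colorable 3 := by
  rintro ⟨c⟩
  obtain ⟨f, hf⟩ := h
  have hne : ∀ i < 11, ∀ j < 11, patternAdj grotzschPattern i j = true → c (f i) ≠ c (f j) :=
    fun i hi j hj hij => c.valid ((hf i hi j hj).mp hij)
  -- Mycielski's argument: base vertices sharing the color of the apex 10 take the color of their
  -- shadow `i + 5`, leaving two colors for the 5-cycle.
  have hz : ∀ i < 5, (if c (f i) = c (f 10) then c (f (i + 5)) else c (f i)) ≠ c (f 10) := by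
    intro i hi
    split_ifs with h
    · exact hne _ (by omega) _ (by omega) (by interval_cases i <;> rfl)
    · exact h
  have hstep : ∀ i < 5, ∀ j < 5, patternAdj grotzschPattern i j = true →
      patternAdj grotzschPattern (i + 5) j = true → patternAdj grotzschPattern i (j + 5) = true →
      (if c (f i) = c (f 10) then c (f (i + 5)) else c (f i)) ≠
        (if c (f j) = c (f 10) then c (f (j + 5)) else c (f j)) := by
    intro i hi j hj h1 h2 h3
    split_ifs with hi' hj' hj'
    · exact absurd (hi'.trans hj'.symm) (hne _ (by omega) _ (by omega) h1)
    · exact hne _ (by omega) _ (by omega) h2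
    · exact hne _ (by omega) _ (by omega) h3
    · exact hne _ (by omega) _ (by omega) h1
  exact not_exists_two_coloring_five_cycle _ _ _ _ _ _ ⟨hz 0 (by omega), hz 1 (by omega),
    hz 2 (by omega), hz 3 (by omega), hz 4 (by omega), hstep 0 (by omega) 1 (by omega) rfl rfl rfl,
    hstep 1 (by omega) 2 (by omega) rfl rfl rfl, hstep 2 (by omega) 3 (by omega) rfl rfl rfl,
    hstep 3 (by omega) 4 (by omega) rfl rfl rfl, hstep 4 (by omega) 0 (by omega) rfl rfl rfl⟩

end

/-! ### Odd holes and bipartite non-neighbourhoods. -/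

section OddHoles

variable {V : Type*} {G : SimpleGraph V}

/-- A shortest odd closed walk of a graph that is not bipartite is an induced cycle. -/
theorem exists_induced_odd_cycle (h : ¬ G.Colorable 2) :
    ∃ (n : ℕ) (f : ℕ → V), Odd n ∧ 3 ≤ n ∧ ∀ i < n, ∀ j < i,
      (G.Adj (f i) (f j) ↔ i = j + 1 ∨ (j = 0 ∧ i + 1 = n)) := by
  classical
  have hex : ∃ n, Odd n ∧ ∃ (u : V) (w : G.Walk u u), w.length = n := by
    rw [SimpleGraph.two_colorable_iff_forall_loop_even] at h
    push Not at h
    obtain ⟨u, w, hw⟩ := h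
    exact ⟨_, Nat.not_even_iff_odd.mp hw, u, w, rfl⟩
  obtain ⟨hodd, u, w, hw⟩ := Nat.find_spec hex
  have hmin : ∀ {m : ℕ} {v : V} (p : G.Walk v v), p.length = m → Odd m → Nat.find hex ≤ m :=
    fun p hp hm => Nat.find_min' hex ⟨hm, _, p, hp⟩
  generalize Nat.find hex = n at hodd hw hmin
  have hsucc : ∀ i < n, G.Adj (w.getVert i) (w.getVert (i + 1)) := fun i hi =>
    w.adj_getVert_succ (hw ▸ hi)
  have hn : w.getVert n = w.getVert 0 := by
    rw [← hw, w.getVert_length, w.getVert_zero]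
  have h3 : 3 ≤ n := by
    by_contra hlt
    obtain ⟨k, hk⟩ := hodd
    have h1 : n = 1 := by omega
    subst h1
    have := hsucc 0 (by omega)
    rw [zero_add, hn] at this
    exact this.ne rfl
  refine ⟨n, w.getVert, hodd, h3, fun i hi j hj => ⟨fun hadj => ?_, ?_⟩⟩
  · by_contra hcon
    push Not at hcon
    -- A chord splits the walk into closed walks of total length n + 2, so exactly one is odd;
    -- minimality then makes `i` and `j` consecutive on the closed walk.
    let inner : G.Walk (w.getVert j) (w.getVert i) :=
      ((w.drop j).take (i - j)).copy rfl (by rw [SimpleGraph.Walk.drop_getVert]; congr 1; omega)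
    have hinner : (SimpleGraph.Walk.cons hadj inner).length = i - j + 1 := by
      simp only [inner, SimpleGraph.Walk.length_cons, SimpleGraph.Walk.length_copy,
        SimpleGraph.Walk.take_length, SimpleGraph.Walk.drop_length]
      omega
    have houter : ((w.take j).append (SimpleGraph.Walk.cons hadj.symm (w.drop i))).length =
        j + (n - i + 1) := by
      simp only [SimpleGraph.Walk.length_append, SimpleGraph.Walk.length_cons,
        SimpleGraph.Walk.take_length, SimpleGraph.Walk.drop_length]
      omega
    have h1 := hmin _ hinner
    have h2 := hmin _ houter
    obtain ⟨k, hk⟩ := hodd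
    rcases Nat.even_or_odd (i - j + 1) with he | ho
    · have : Odd (j + (n - i + 1)) := by
        obtain ⟨l, hl⟩ := he
        exact ⟨k + 1 - l, by omega⟩
      have := h2 this
      omega
    · have := h1 ho
      omega
  · rintro (rfl | ⟨rfl, rfl⟩)
    · exact (hsucc j (by omega)).symm
    · rw [← hn]
      exact hsucc i (by omega)

theorem PatternFree.containsPattern_odd_hole (hG : PatternFree G) (h : ¬ G.Colorable 2) :
    ContainsPattern G cyclePattern5 ∨ ContainsPattern G cyclePattern7 := by
  obtain ⟨n, f, hodd, h3, hf⟩ := exists_induced_odd_cycle h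
  by_cases h8 : 8 ≤ n
  · refine absurd ⟨fun i => f (if i < 4 then i else i + 1), realizes_iff.mpr ?_⟩ hG.p2p4
    intro i hi j hj
    have hi : i < 6 := hi
    rw [hf _ (by split_ifs <;> omega) _ (by split_ifs <;> omega)]
    interval_cases i <;> interval_cases j <;> simp [p2p4Pattern, Nat.testBit] <;> omega
  · have hcases : n = 3 ∨ n = 5 ∨ n = 7 := by
      obtain ⟨k, hk⟩ := hodd
      omega
    rcases hcases with rfl | rfl | rfl
    · refine absurd ⟨f, realizes_iff.mpr fun i hi j hj => ?_⟩ hG.triangle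
      have hi : i < 3 := hi
      rw [hf i hi j hj]
      interval_cases i <;> interval_cases j <;> simp [trianglePattern, Nat.testBit]
    · refine Or.inl ⟨f, realizes_iff.mpr fun i hi j hj => ?_⟩
      have hi : i < 5 := hi
      rw [hf i hi j hj]
      interval_cases i <;> interval_cases j <;> simp [cyclePattern5, Nat.testBit]
    · refine Or.inr ⟨f, realizes_iff.mpr fun i hi j hj => ?_⟩
      have hi : i < 7 := hi
      rw [hf i hi j hj]
      interval_cases i <;> interval_cases j <;> simp [cyclePattern7, Nat.testBit]

theorem PatternFree.induce (hG : PatternFree G) (s : Set V) : PatternFree (G.induce s) :=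
  ⟨fun h => hG.triangle (containsPattern_of_isIndContained h ⟨SimpleGraph.Embedding.induce s⟩),
    fun h => hG.p2p4 (containsPattern_of_isIndContained h ⟨SimpleGraph.Embedding.induce s⟩)⟩

/-- The neighbours of `x` are independent and take the third color. -/
theorem colorable_three_of_induce_nonneighbors {x : V}
    (h : (G.induce {v | ¬ G.Adj x v}).Colorable 2) (hG : PatternFree G) : G.Colorable 3 := by
  classical
  obtain ⟨c⟩ := h
  refine ⟨SimpleGraph.Coloring.mk
    (fun v => if hv : G.Adj x v then (2 : Fin 3) else (c ⟨v, hv⟩).castSucc) fun {v w} hvw => ?_⟩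
  have hlt : ∀ a : Fin 2, a.castSucc ≠ (2 : Fin 3) := by decide
  by_cases hv : G.Adj x v <;> by_cases hw : G.Adj x w
  · refine absurd ⟨fun i => if i = 0 then x else if i = 1 then v else w, realizes_iff.mpr ?_⟩
      hG.triangle
    intro i hi j hj
    have hi : i < 3 := hi
    interval_cases i <;> interval_cases j <;>
      simp [trianglePattern, Nat.testBit, hv.symm, hw.symm, hvw.symm]
  · simp [hv, hw, (hlt _).symm]
  · simp [hv, hw, hlt]
  · simp only [hv, hw, dif_neg, not_false_eq_true, ne_eq, Fin.castSucc_inj]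
    exact c.valid (v := ⟨v, hv⟩) (w := ⟨w, hw⟩) hvw

end OddHoles

/-! ### Graphs without comparable pairs. -/

section Reduced

variable {V : Type u} {G : SimpleGraph V}

theorem exists_adj_not_adj_of_not_comparable (hred : ∀ u v, ¬ IsComparablePair G u v) {u v : V}
    (hne : u ≠ v) (huv : ¬ G.Adj u v) : ∃ w, G.Adj u w ∧ ¬ G.Adj v w := by
  by_contra h
  push Not at h
  exact hred u v ⟨hne, huv, fun w hw => h w hw⟩

theorem attached_zero {f : ℕ → V} {n : ℕ} {x : V} (h : ∀ i < n, ¬ G.Adj x (f i)) :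
    Attached G f n 0 x := fun i hi => by simp [h i hi]

/-- Index 7 is a vertex with no neighbour on the 7-hole; it must then be isolated in the whole
graph. -/
theorem attachments_cyclePattern7 :
    ((admissible [] (cyclePattern7 ++ [0])).all fun S => !S.testBit 7) = true := by
  decide +kernel

/-- If a graph without triangles, induced `P₂ ∪ P₄` and comparable pairs is not 3-colorable, then
it has a 5-hole and a vertex without neighbours in this hole. -/
theorem PatternFree.containsPattern_cycleIsolated (hG : PatternFree G)
    (hred : ∀ u v, ¬ IsComparablePair G u v) (hcol : ¬ G.Colorable 3) :
    ContainsPattern G cycleIsolatedPattern := by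
  obtain ⟨x⟩ : Nonempty V := by
    by_contra hV
    rw [not_nonempty_iff] at hV
    exact hcol (.of_isEmpty 3)
  have h2 : ¬ (G.induce {v | ¬ G.Adj x v}).Colorable 2 := fun h =>
    hcol (colorable_three_of_induce_nonneighbors h hG)
  have hlift : ∀ {H : List ℕ} {f : ℕ → {v | ¬ G.Adj x v}},
      Realizes (G.induce {v | ¬ G.Adj x v}) H f →
        Realizes G (H ++ [0]) (Function.update (fun i => (f i : V)) H.length x) := by
    intro H f hf
    have hf' : Realizes G H fun i => (f i : V) := fun i hi j hj => hf i hi j hj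
    exact hf'.concat (attached_zero fun i _ => (f i).2)
  rcases (hG.induce _).containsPattern_odd_hole h2 with ⟨f, hf⟩ | ⟨f, hf⟩
  · exact ⟨_, hlift hf⟩
  · exfalso
    have h01 : G.Adj (f 0) (f 1) := (hf 0 (by decide) 1 (by decide)).mp rfl
    have hne : ∀ a b : V, G.Adj a b → ¬ G.Adj x b → x ≠ a := by
      rintro a b hab hxb rfl
      exact hxb hab
    obtain ⟨y, hxy, -⟩ := exists_adj_not_adj_of_not_comparable hred (hne _ _ h01 (f 1).2) (f 0).2
    obtain ⟨S, hS, -, hatt⟩ := hG.exists_admissible (certs := []) (by simp) (hlift hf) y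
    have h7 := attachments_cyclePattern7
    simp only [List.all_eq_true] at h7
    have h1 := hatt 7 (by decide)
    have h3 : Function.update (fun i => (f i : V)) cyclePattern7.length x 7 = x :=
      Function.update_self ..
    rw [h3] at h1
    have h4 := h7 S hS
    rw [h1.mpr hxy.symm] at h4
    exact Bool.noConfusion h4

/-- The attachment to `cycleIsolatedPattern` of a neighbour of `z` joined to the two neighbours of
the `s`-th vertex of the cycle. -/
def spokeMask (s : Fin 5) : ℕ := 32 + 2 ^ (s + 1).val + 2 ^ (s + 4).val

/-- With at most one neighbour on the cycle, an edge at z would miss an induced P₄; three would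
create a triangle. -/
theorem admissible_cycleIsolatedPattern : ∀ S ∈ admissible [] cycleIsolatedPattern,
    S.testBit 5 = true → ∃ s, S = spokeMask s := by
  decide +kernel

theorem embedsAt_corePattern01 : ∀ s : Fin 5, embedsAt corePattern01
    (cycleIsolatedPattern ++ [spokeMask s] ++ [spokeMask (s + 1)])
    [s, (s + 1).val, (s + 2).val, (s + 3).val, (s + 4).val, 5, 6, 7] = true := by
  decide +kernel

theorem spokeMask_lt : ∀ s : Fin 5, spokeMask s < 2 ^ 6 := by decide

theorem spokeMask_testBit : ∀ s i : Fin 5,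
    (spokeMask s).testBit i = false → s ≠ i + 1 ∧ s ≠ i + 4 := by decide

theorem consecutive_of_avoiding : ∀ a b c : Fin 5, (b ≠ a + 1 + 1 ∧ b ≠ a + 1 + 4) →
    (c ≠ a + 4 + 1 ∧ c ≠ a + 4 + 4) →
    b = a + 1 ∨ a = b + 1 ∨ c = a + 1 ∨ a = c + 1 ∨ b = c + 1 ∨ c = b + 1 := by decide

theorem PatternFree.containsPattern_core (hG : PatternFree G)
    (hred : ∀ u v, ¬ IsComparablePair G u v) (h : ContainsPattern G cycleIsolatedPattern) :
    ContainsPattern G corePattern01 := by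
  obtain ⟨f, hf⟩ := h
  have hlen : cycleIsolatedPattern.length = 6 := rfl
  have hz : ∀ i : Fin 5, ∃ (s : Fin 5) (u : V), G.Adj u (f 5) ∧
      Attached G f 6 (spokeMask s) u ∧ s ≠ i + 1 ∧ s ≠ i + 4 := by
    intro i
    have hzi : ∀ j < 5, ¬ G.Adj (f 5) (f j) := fun j hj => by
      rw [← hf 5 (by decide) j (by rw [hlen]; omega)]
      interval_cases j <;> decide
    have hne : f 5 ≠ f i := by
      intro heq
      have h1 : G.Adj (f i) (f (i + 1 : Fin 5).val) := by
        rw [← hf _ (by rw [hlen]; omega) _ (by rw [hlen]; omega)]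
        clear hzi heq
        revert i
        decide
      exact hzi _ (i + 1).isLt (heq ▸ h1)
    -- Since z and the cycle vertex `f i` are not comparable, some neighbour of z misses `f i`.
    obtain ⟨u, hu, hui⟩ := exists_adj_not_adj_of_not_comparable hred hne (hzi i i.isLt)
    obtain ⟨S, hS, -, hatt⟩ := hG.exists_admissible (certs := []) (by simp) hf u
    obtain ⟨s, rfl⟩ := admissible_cycleIsolatedPattern S hS
      ((hatt 5 (by decide)).mpr hu.symm)
    refine ⟨s, u, hu.symm, hatt, spokeMask_testBit s i (Bool.eq_false_iff.mpr fun h => ?_)⟩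
    exact hui ((hatt i (by rw [hlen]; omega)).mp h).symm
  have hcons : ∀ {s t : Fin 5} {u v : V}, G.Adj u (f 5) → G.Adj v (f 5) →
      Attached G f 6 (spokeMask s) u → Attached G f 6 (spokeMask t) v → t = s + 1 →
      ContainsPattern G corePattern01 := by
    rintro s t u v hu hv hus hvt rfl
    have huv : ¬ G.Adj v u := by
      intro huv
      refine hG.triangle ⟨fun i => if i = 0 then f 5 else if i = 1 then u else v,
        realizes_iff.mpr ?_⟩
      intro i hi j hj
      have hi : i < 3 := hi
      interval_cases i <;> interval_cases j <;> simp [trianglePattern, Nat.testBit, hu, hv, huv]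
    exact ((hf.concat hus).concat (by
      rw [List.length_append, hlen]
      exact hvt.zero (spokeMask_lt _) huv)).contains_of_embedsAt (embedsAt_corePattern01 s)
  -- Avoiding a + 1 leaves b in {a + 1, a + 3, a + 4}, avoiding a + 4 leaves c in {a + 1, a + 2, a +
  -- 4}; if neither is next to a, then b = a + 3 and c = a + 2.
  obtain ⟨a, u, hu, hau, -⟩ := hz 0
  obtain ⟨b, v, hv, hbv, hb⟩ := hz (a + 1)
  obtain ⟨c, w, hw, hcw, hc⟩ := hz (a + 4)
  rcases consecutive_of_avoiding a b c hb hc with h | h | h | h | h | h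
  exacts [hcons hu hv hau hbv h, hcons hv hu hbv hau h, hcons hu hw hau hcw h,
    hcons hw hu hcw hau h, hcons hw hv hcw hbv h, hcons hv hw hbv hcw h]

theorem colorable_of_induce_compl {u v : V} (h : IsComparablePair G u v) {n : ℕ}
    (hcol : (G.induce ({u}ᶜ : Set V)).Colorable n) : G.Colorable n := by
  classical
  obtain ⟨c⟩ := hcol
  obtain ⟨hne, -, hsub⟩ := h
  let r : V → ({u}ᶜ : Set V) := fun x => if hx : x = u then ⟨v, hne.symm⟩ else ⟨x, hx⟩
  refine ⟨SimpleGraph.Coloring.mk (fun x => c (r x)) fun {x y} hxy => c.valid ?_⟩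
  by_cases hx : x = u
  · subst hx
    have hy : y ≠ x := hxy.ne'
    simpa [r, hy] using hsub hxy
  · by_cases hy : y = u
    · subst hy
      simpa [r, hx] using (hsub hxy.symm).symm
    · simpa [r, hx, hy] using hxy

/-- A finite graph without triangles and induced `P₂ ∪ P₄` which is not 3-colorable contains the
Grötzsch graph. -/
theorem PatternFree.containsPattern_grotzschPattern [Finite V] (hG : PatternFree G)
    (hcol : ¬ G.Colorable 3) : ContainsPattern G grotzschPattern := by
  induction hn : Nat.card V using Nat.strong_induction_on generalizing V with
  | _ n ih =>
    by_contra hF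
    by_cases hred : ∀ u v, ¬ IsComparablePair G u v
    · exact hcol (hG.colorable_three_of_core hF
        (hG.containsPattern_core hred (hG.containsPattern_cycleIsolated hred hcol)))
    · push Not at hred
      obtain ⟨u, v, huv⟩ := hred
      have hlt : Nat.card ({u}ᶜ : Set V) < n :=
        hn ▸ Finite.card_subtype_lt (x := u) (by simp)
      exact hF (containsPattern_of_isIndContained
        (ih _ hlt (hG.induce {u}ᶜ) (fun h => hcol (colorable_of_induce_compl huv h)) rfl)
        ⟨SimpleGraph.Embedding.induce _⟩)

end Reduced

/-! ### Replications and blow-ups. -/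

section Replication

theorem IsReplicationVertexAddition.colorable_iff {V W : Type u} {H : SimpleGraph W}
    {G : SimpleGraph V} (h : IsReplicationVertexAddition H G) (n : ℕ) :
    H.Colorable n ↔ G.Colorable n := by
  obtain ⟨u, v, huv, ⟨e⟩⟩ := h
  exact ⟨fun hH => colorable_of_induce_compl huv (hH.of_hom e.symm.toHom),
    fun hG => (hG.of_hom (SimpleGraph.Embedding.induce _).toHom).of_hom e.toHom⟩

theorem ObtainedByReplications.colorable_iff {V W : Type u} {H : SimpleGraph W}
    {G : SimpleGraph V} (h : ObtainedByReplications H G) (n : ℕ) :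
    H.Colorable n ↔ G.Colorable n := by
  induction h with
  | start e => exact ⟨fun h => h.of_hom e.symm.toHom, fun h => h.of_hom e.toHom⟩
  | step _ h' ih => exact ih.trans (h'.colorable_iff n)

/-- A graph that is a blow-up of an induced subgraph of `C` is obtained by replications from an
induced subgraph of `C`, which contains the twin-free graphs that the blow-up contains. -/
theorem exists_obtainedByReplications {T : Type*} {C : SimpleGraph T} {F : List ℕ} {V : Type u}
    [Finite V] {G : SimpleGraph V} (t : V → T) (ht : ∀ x y, G.Adj x y ↔ C.Adj (t x) (t y))
    (hF : ContainsPattern G F) :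
    ∃ (W : Type u) (H : SimpleGraph W), ContainsPattern H F ∧ H ⊴ C ∧
      ObtainedByReplications H G := by
  induction hn : Nat.card V using Nat.strong_induction_on generalizing V with
  | _ n ih =>
    by_cases hinj : Function.Injective t
    · exact ⟨V, G, hF, ⟨⟨⟨t, hinj⟩, (ht _ _).symm⟩⟩, .start .refl⟩
    · classical
      simp only [Function.Injective] at hinj
      push Not at hinj
      obtain ⟨u, v, huv, hne⟩ := hinj
      have hlt : Nat.card ({u}ᶜ : Set V) < n :=
        hn ▸ Finite.card_subtype_lt (x := u) (by simp)
      -- As `u` and `v` are twins, sending `u` to `v` moves any copy of `F` off `u`.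
      let r : V → ({u}ᶜ : Set V) := fun x => if hx : x = u then ⟨v, hne.symm⟩ else ⟨x, hx⟩
      have hr : ∀ x, t (r x) = t x := by
        intro x
        by_cases hx : x = u
        · simp [r, hx, huv]
        · simp [r, hx]
      obtain ⟨f, hf⟩ := hF
      obtain ⟨W, H, hHF, hHC, hHG⟩ := ih _ hlt (G := G.induce ({u}ᶜ : Set V)) (fun x => t x)
        (fun x y => ht x y) ⟨fun i => r (f i), fun i hi j hj => by
          rw [hf i hi j hj, ht, SimpleGraph.induce_adj, ht, hr, hr]⟩ rfl
      refine ⟨W, H, hHF, hHC, .step hHG ⟨u, v, ⟨hne, ?_, ?_⟩, ⟨.refl⟩⟩⟩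
      · rw [ht, huv]
        exact C.irrefl
      · intro w hw
        rw [SimpleGraph.mem_neighborSet, ht] at hw ⊢
        rwa [← huv]

/-- Twice the last coordinate plus the parity of the other three: antipodes differ in the first
term, cube neighbours in exactly one of the two. -/
def clebschColoring (x : Fin 4 → Bool) : Fin 4 :=
  [0, 1, 1, 0, 1, 0, 0, 1, 2, 3, 3, 2, 3, 2, 2, 3].getD
    ((x 0).toNat + 2 * (x 1).toNat + 4 * (x 2).toNat + 8 * (x 3).toNat) 0

theorem clebschGraph_colorable_four : clebschGraph.Colorable 4 := by
  have h : ∀ x y, clebschGraph.Adj x y → clebschColoring x ≠ clebschColoring y := by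
    decide +kernel
  exact ⟨SimpleGraph.Coloring.mk clebschColoring fun {x y} hxy => h x y hxy⟩

end Replication

/-! ### The main theorem. -/

theorem not_colorable_two_of_hasHole {V : Type*} {G : SimpleGraph V} {k : ℕ} (hk : Odd k)
    (h : HasHole G k) : ¬ G.Colorable 2 := by
  obtain ⟨h4, ⟨e⟩⟩ := h
  intro hcol
  have h1 := (hcol.of_hom e.toHom).chromaticNumber_le
  rw [SimpleGraph.chromaticNumber_cycleGraph_of_odd k (by omega) hk] at h1
  exact absurd h1 (by decide)

theorem mainTheorem3 {V : Type u} [Finite V] (G : SimpleGraph V) (hconn : G.Connected)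
    (hP : InducedFree P2UnionP4 G) (hC : InducedFree (SimpleGraph.cycleGraph 3) G) :
    ((G.chromaticNumber = 4 ↔
        ∃ (W : Type u) (H : SimpleGraph W),
          grotzschGraph.IsIndContained H ∧ H.IsIndContained clebschGraph ∧
            ObtainedByReplications H G) ∧
      (G.chromaticNumber = 4 → grotzschGraph.IsIndContained G)) ∧
    (G.chromaticNumber = 3 ↔
      (HasHole G 5 ∨ HasHole G 7) ∧ InducedFree grotzschGraph G) := by
  have hG : PatternFree G := .of_inducedFree hP hC
  have h4 : G.chromaticNumber = 4 ↔ G.Colorable 4 ∧ ¬ G.Colorable 3 :=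
    SimpleGraph.chromaticNumber_eq_iff_colorable_not_colorable (n := 3)
  have h3 : G.chromaticNumber = 3 ↔ G.Colorable 3 ∧ ¬ G.Colorable 2 :=
    SimpleGraph.chromaticNumber_eq_iff_colorable_not_colorable (n := 2)
  rw [h4, h3]
  refine ⟨⟨⟨fun h => ?_, ?_⟩, fun h =>
    containsPattern_grotzschPattern_iff.mp (hG.containsPattern_grotzschPattern h.2)⟩, ?_, ?_⟩
  · have hF := hG.containsPattern_grotzschPattern h.2
    obtain ⟨t, ht⟩ := hG.exists_clebsch_map hconn hF
    obtain ⟨W, H, h1, h2, h3⟩ := exists_obtainedByReplications t ht hF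
    exact ⟨W, H, containsPattern_grotzschPattern_iff.mp h1, h2, h3⟩
  · rintro ⟨W, H, hF, ⟨e⟩, hHG⟩
    rw [← hHG.colorable_iff, ← hHG.colorable_iff]
    exact ⟨clebschGraph_colorable_four.of_hom e.toHom,
      not_colorable_three_of_grotzschPattern (containsPattern_grotzschPattern_iff.mpr hF)⟩
  · rintro ⟨hcol, h2⟩
    refine ⟨?_, fun hF =>
      not_colorable_three_of_grotzschPattern (containsPattern_grotzschPattern_iff.mpr hF) hcol⟩
    rcases hG.containsPattern_odd_hole h2 with h | h
    · exact Or.inl ⟨by norm_num, cycleGraph_five_isIndContained h⟩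
    · exact Or.inr ⟨by norm_num, cycleGraph_seven_isIndContained h⟩
  · rintro ⟨hhole, hF⟩
    constructor
    · by_contra hcol
      exact hF (containsPattern_grotzschPattern_iff.mp (hG.containsPattern_grotzschPattern hcol))
    · rcases hhole with h | h
      · exact not_colorable_two_of_hasHole (by decide) h
      · exact not_colorable_two_of_hasHole (by decide) h
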